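/- Let $F_1,\dots,F_K:\mathbb R^d\to\mathbb R$ ($K\ge 1$) be $L$-smooth (differentiable with $L$-Lipschitz gradient), let $f=\frac1K\sum_{k=1}^K F_k$ be weakly convex, i.e. $f(x)\ge f(y)+\langle\nabla f(y),x-y\rangle$ for all $x,y$, and let $\hat w$ be a minimizer of $f$. Fix $w^0\in\mathbb R^d$ and $0<\varepsilon\le\min\{L,\tfrac12\}$, and put $F_k^{\varepsilon}(w)=F_k(w)+\frac{\varepsilon}{2}\|w-w^0\|^2$, $f_\varepsilon=\frac1K\sum_k F^\varepsilon_k=f+\frac\varepsilon2\|\cdot-w^0\|^2$. InexactDANE. For $\phi=\frac1K\sum_k\Phi_k$, one iteration of InexactDANE with parameters $\eta,\gamma,\mu$ maps a point $v$ to $\frac1K\sum_k z_k$, where each $z_k$ is any point with $\|\nabla g_k(z_k)\|\le\gamma\|\nabla g_k(v)\|$ for the local objective $g_k(w)=\Phi_k(w)-\langle\nabla\Phi_k(v)-\eta\nabla\phi(v),w\rangle+\frac\mu2\|w-v\|^2$. AIDE on $\phi$ with parameters $\lambda,\tau,s,\eta,\gamma,\mu$: let $q=\lambda/(\lambda+\tau)$,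 $y^0=w^0$, $\zeta_0=\sqrt q$. In iteration $t\ge1$, $w^t$ is the result of $s$ iterations of InexactDANE (with $\eta,\gamma,\mu$) started at $w^{t-1}$ and applied to $\frac1K\sum_k\big(\Phi_k+\frac\tau2\|\cdot-y^{t-1}\|^2\big)$; then $\zeta_t\in(0,1)$ satisfies $\zeta_t^2=(1-\zeta_t)\zeta_{t-1}^2+q\zeta_t$, and $y^t=w^t+\beta_t(w^t-w^{t-1})$ with $\beta_t=\frac{\zeta_{t-1}(1-\zeta_{t-1})}{\zeta_{t-1}^2+\zeta_t}$. Claim. There is a universal constant $C>0$ (independent of $d,K,F_1,\dots,F_K,L,\varepsilon,w^0,\hat w$) such that the following holds. Apply AIDE to $f_\varepsilon$, started at $w^0$, with $\lambda=\varepsilon$, $\tau=L$, $\eta=1$, $\gamma=\frac18$, $\mu=12(L+\varepsilon)$ and any integer $s\ge C\,(1+\log(L/\varepsilon))$, so that $s=\tilde O(1)$ is allowed. Then for every integer $$t\;\ge\; C\,\sqrt{L/\varepsilon}\,\log(1/\varepsilon)\,\bigl(1+\log(L/\varepsilon)\bigr),$$ i.e. after $t=\tilde O(\sqrt{L/\varepsilon}\,\log(1/\varepsilon))$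 iterations, every run of AIDE satisfies $$f(w^t)\;\le\; f(\hat w)+\varepsilon\Bigl[\tfrac12\|\hat w-w^0\|^2+f(w^0)-f(\hat w)\Bigr]=f(\hat w)+O(\varepsilon).$$ -/

import Mathlib

open scoped RealInnerProductSpace

noncomputable section

namespace AIDE

/-- Euclidean space `ℝ^d` with the standard inner product and norm. -/
abbrev E (d : ℕ) := EuclideanSpace ℝ (Fin d)

/-- `ψ` is `L`-smooth: differentiable with `L`-Lipschitz gradient. -/
def IsSmooth {d : ℕ} (L : ℝ) (ψ : E d → ℝ) : Prop :=
  Differentiable ℝ ψ ∧ ∀ x y, ‖gradient ψ x - gradient ψ y‖ ≤ L * ‖x - y‖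

/-- `ψ` is `lam`-strongly convex, in the first-order form used for differentiable functions. -/
def IsStronglyConvex {d : ℕ} (lam : ℝ) (ψ : E d → ℝ) : Prop :=
  ∀ x y, ψ y + ⟪gradient ψ y, x - y⟫ + lam / 2 * ‖x - y‖ ^ 2 ≤ ψ x

/-- Weakly convex means `0`-strongly convex. -/
def IsWeaklyConvex {d : ℕ} (ψ : E d → ℝ) : Prop :=
  IsStronglyConvex 0 ψ

/-- The global objective `f = (1/K) ∑ₖ Fₖ`. -/
def avg {d K : ℕ} (F : Fin K → E d → ℝ) (w : E d) : ℝ :=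
  (1 / (K : ℝ)) * ∑ k, F k w

/-- The local functions `Fₖ + (c/2) ‖· - p‖²`; their average is `f + (c/2) ‖· - p‖²`. -/
def addProx {d K : ℕ} (F : Fin K → E d → ℝ) (c : ℝ) (p : E d) : Fin K → E d → ℝ :=
  fun k w => F k w + c / 2 * ‖w - p‖ ^ 2

/-- The local subproblem of machine `k` at the current point `v`:
`Fₖ(w) - ⟨∇Fₖ(v) - η ∇f(v), w⟩ + (μ/2) ‖w - v‖²`. -/
def localObj {d K : ℕ} (F : Fin K → E d → ℝ) (η μ : ℝ) (v : E d) (k : Fin K) (w : E d) : ℝ :=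
  F k w - ⟪gradient (F k) v - η • gradient (avg F) v, w⟫ + μ / 2 * ‖w - v‖ ^ 2

/-- `v'` can be the outcome of one iteration of InexactDANE (with the gradient inexactness
criterion) from `v`: each machine finds a point at which the gradient of its subproblem has
norm at most `γ` times the norm at `v`, and these points are averaged. -/
def IsInexactDANEStep {d K : ℕ} (F : Fin K → E d → ℝ) (η γ μ : ℝ) (v v' : E d) : Prop :=
  ∃ z : Fin K → E d,
    (∀ k, ‖gradient (localObj F η μ v k) (z k)‖ ≤ γ * ‖gradient (localObj F η μ v k) v‖) ∧
    v' = (1 / (K : ℝ)) • ∑ k, z k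

/-- `v'` can be the outcome of `s` iterations of InexactDANE started at `v`. -/
def IsInexactDANE {d K : ℕ} (F : Fin K → E d → ℝ) (η γ μ : ℝ) (s : ℕ) (v v' : E d) : Prop :=
  ∃ u : ℕ → E d, u 0 = v ∧ u s = v' ∧ ∀ j < s, IsInexactDANEStep F η γ μ (u j) (u (j + 1))

/-- `w 0, …, w T` are the iterates of a run of `T` iterations of AIDE on `avg F` started at
`w0`, with parameters `lam, τ, s, η, γ, μ`; `y` are the extrapolated points and `ζ` the
momentum parameters, initialised by `ζ 0 = √q`, `q = lam / (lam + τ)`. -/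
def IsAIDERun {d K : ℕ} (F : Fin K → E d → ℝ) (w0 : E d) (lam τ : ℝ) (s : ℕ) (η γ μ : ℝ)
    (T : ℕ) (w : ℕ → E d) : Prop :=
  ∃ (y : ℕ → E d) (ζ : ℕ → ℝ),
    w 0 = w0 ∧ y 0 = w0 ∧ ζ 0 = √(lam / (lam + τ)) ∧
    ∀ t < T,
      IsInexactDANE (addProx F τ (y t)) η γ μ s (w t) (w (t + 1)) ∧
      ζ (t + 1) ∈ Set.Ioo (0 : ℝ) 1 ∧
      ζ (t + 1) ^ 2 = (1 - ζ (t + 1)) * ζ t ^ 2 + lam / (lam + τ) * ζ (t + 1) ∧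
      y (t + 1) = w (t + 1) +
        (ζ t * (1 - ζ t) / (ζ t ^ 2 + ζ (t + 1))) • (w (t + 1) - w t)

end AIDE

end

open scoped RealInnerProductSpace

namespace AIDE

/-! ### Gradients of proximal, local and averaged objectives -/

variable {d K : ℕ}

/-! Put `l = L + ε`. With `μ = 12 l`, an InexactDANE step is gradient descent up to a relative error
7/20, so it contracts the gap of the `l`-strongly convex proximal subproblem by 13/14
(`IsInexactDANEStep.gap_le`). AIDE is thus an inexact accelerated proximal point method on `f_ε`.
Since `ζ` starts at its fixed point `a = √q`, momentum is constant, and the gap plus the squared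
distance from an estimate point to the minimizer is a potential (`potential_step_le`). The
subproblem gradient at the warm start is bounded by this potential, so logarithmically many inner
steps leave an error the decay absorbs, giving the factor `1 - a/2` (`IsAIDERun.gap_le`). After the
stated number of outer steps the gap of `f_ε` is at most `ε` times its initial value; comparing
`f_ε` with `f` at `what` finishes. -/

lemma hasGradientAt_add_prox {ψ : E d → ℝ} {g w : E d} (h : HasGradientAt ψ g w) (c : ℝ) (p : E d) :
    HasGradientAt (fun w => ψ w + c / 2 * ‖w - p‖ ^ 2) (g + c • (w - p)) w := by
  rw [hasGradientAt_iff_hasFDerivAt] at h ⊢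
  have h2 := ((hasFDerivAt_id (𝕜 := ℝ) w).sub_const p).norm_sq.const_mul (c / 2)
  refine (h.add h2).congr_fderiv ?_
  ext v
  simp
  ring

lemma hasGradientAt_localObj {F : Fin K → E d → ℝ} {k : Fin K} (h : Differentiable ℝ (F k))
    (η μ : ℝ) (v w : E d) :
    HasGradientAt (localObj F η μ v k)
      (gradient (F k) w - (gradient (F k) v - η • gradient (avg F) v) + μ • (w - v)) w := by
  refine hasGradientAt_add_prox
    (ψ := fun w => F k w - ⟪gradient (F k) v - η • gradient (avg F) v, w⟫) ?_ μ v
  have h1 := (h w).hasGradientAt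
  rw [hasGradientAt_iff_hasFDerivAt] at h1 ⊢
  refine (h1.sub (innerSL ℝ (gradient (F k) v - η • gradient (avg F) v)).hasFDerivAt).congr_fderiv ?_
  ext u
  simp

lemma hasGradientAt_avg {F : Fin K → E d → ℝ} (h : ∀ k, Differentiable ℝ (F k)) (w : E d) :
    HasGradientAt (avg F) ((1 / (K : ℝ)) • ∑ k, gradient (F k) w) w := by
  rw [hasGradientAt_iff_hasFDerivAt]
  refine ((HasFDerivAt.fun_sum (u := Finset.univ) fun k _ =>
    ((h k w).hasGradientAt).hasFDerivAt).const_mul (1 / (K : ℝ))).congr_fderiv ?_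
  ext u
  simp

lemma avg_addProx (hK : 0 < K) (F : Fin K → E d → ℝ) (c : ℝ) (p : E d) :
    avg (addProx F c p) = fun w => avg F w + c / 2 * ‖w - p‖ ^ 2 := by
  ext w
  have : (K : ℝ) ≠ 0 := by positivity
  simp only [avg, addProx, Finset.sum_add_distrib, Finset.sum_const, Finset.card_univ,
    Fintype.card_fin, nsmul_eq_mul]
  field_simp

lemma norm_avg_sub_le (hK : 0 < K) {z : Fin K → E d} {x : E d} {r : ℝ}
    (h : ∀ k, ‖z k - x‖ ≤ r) : ‖(1 / (K : ℝ)) • ∑ k, z k - x‖ ≤ r := by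
  have hK' : (0 : ℝ) < K := by positivity
  have : (1 / (K : ℝ)) • ∑ k, z k - x = (1 / (K : ℝ)) • ∑ k, (z k - x) := by
    rw [Finset.sum_sub_distrib, smul_sub]
    simp [← Nat.cast_smul_eq_nsmul ℝ, smul_smul, hK'.ne']
  rw [this, norm_smul, Real.norm_of_nonneg (by positivity)]
  calc 1 / (K : ℝ) * ‖∑ k, (z k - x)‖ ≤ 1 / (K : ℝ) * ∑ _k : Fin K, r := by
        gcongr
        exact norm_sum_le_of_le _ fun k _ => h k
    _ = r := by simp [hK'.ne']

/-! ### Smoothness and strong convexity -/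

namespace IsSmooth

lemma add_prox {L c : ℝ} {ψ : E d → ℝ} (h : IsSmooth L ψ) (hc : 0 ≤ c) (p : E d) :
    IsSmooth (L + c) (fun w => ψ w + c / 2 * ‖w - p‖ ^ 2) := by
  have hg := fun w => hasGradientAt_add_prox (h.1 w).hasGradientAt c p
  refine ⟨fun w => (hg w).differentiableAt, fun x y => ?_⟩
  rw [(hg x).gradient, (hg y).gradient]
  calc ‖gradient ψ x + c • (x - p) - (gradient ψ y + c • (y - p))‖
      = ‖(gradient ψ x - gradient ψ y) + c • (x - y)‖ := by congr 1; module
    _ ≤ L * ‖x - y‖ + c * ‖x - y‖ := by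
        refine (norm_add_le _ _).trans (add_le_add (h.2 x y) ?_)
        rw [norm_smul, Real.norm_of_nonneg hc]
    _ = (L + c) * ‖x - y‖ := by ring

lemma avg {L : ℝ} (hK : 0 < K) {F : Fin K → E d → ℝ} (h : ∀ k, IsSmooth L (F k)) :
    IsSmooth L (avg F) := by
  have hg := hasGradientAt_avg fun k => (h k).1
  refine ⟨fun w => (hg w).differentiableAt, fun x y => ?_⟩
  rw [(hg x).gradient, (hg y).gradient, ← smul_sub, ← Finset.sum_sub_distrib]
  simpa using norm_avg_sub_le hK (x := 0)
    (z := fun k => gradient (F k) x - gradient (F k) y) fun k => by simpa using (h k).2 x y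

lemma le_quadratic {L : ℝ} {ψ : E d → ℝ} (h : IsSmooth L ψ) (x p : E d) :
    ψ (x + p) ≤ ψ x + ⟪gradient ψ x, p⟫ + L / 2 * ‖p‖ ^ 2 := by
  have hline (s : ℝ) : HasDerivAt (fun s : ℝ => x + s • p) p s := by
    simpa using ((hasDerivAt_id s).smul_const p).const_add x
  have hd (s : ℝ) : HasDerivAt
      (fun s : ℝ => ψ (x + s • p) - s * ⟪gradient ψ x, p⟫ - s ^ 2 * (L / 2 * ‖p‖ ^ 2))
      (⟪gradient ψ (x + s • p) - gradient ψ x, p⟫ - s * (L * ‖p‖ ^ 2)) s := by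
    have h1 := ((h.1 (x + s • p)).hasGradientAt).hasFDerivAt.comp_hasDerivAt s (hline s)
    have h2 := (hasDerivAt_id s).mul_const ⟪gradient ψ x, p⟫
    have h3 := ((hasDerivAt_id s).pow 2).mul_const (L / 2 * ‖p‖ ^ 2)
    refine ((h1.sub h2).sub h3).congr_deriv ?_
    simp [inner_sub_left]
    ring
  have hanti := antitoneOn_of_deriv_nonpos (convex_Icc (0 : ℝ) 1)
    (fun s _ => (hd s).continuousAt.continuousWithinAt)
    (fun s _ => (hd s).differentiableAt.differentiableWithinAt) (fun s hs => by
      rw [interior_Icc] at hs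
      rw [(hd s).deriv]
      have h1 := real_inner_le_norm (gradient ψ (x + s • p) - gradient ψ x) p
      have h2 := h.2 (x + s • p) x
      rw [add_sub_cancel_left, norm_smul, Real.norm_of_nonneg hs.1.le] at h2
      nlinarith [mul_le_mul_of_nonneg_right h2 (norm_nonneg p)])
  have := hanti (Set.left_mem_Icc.2 zero_le_one) (Set.right_mem_Icc.2 zero_le_one) zero_le_one
  simp [-inner_gradient_left] at this
  linarith

/-- A gradient step certifies that a small function gap forces a small gradient. -/
lemma norm_gradient_sq_le {L B : ℝ} (hL : 0 < L) {ψ : E d → ℝ} (h : IsSmooth L ψ) (w : E d)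
    (hB : ∀ x, ψ w - ψ x ≤ B) : ‖gradient ψ w‖ ^ 2 ≤ 2 * L * B := by
  have h1 := h.le_quadratic w (-(1 / L) • gradient ψ w)
  have h2 := hB (w + -(1 / L) • gradient ψ w)
  rw [inner_smul_right, real_inner_self_eq_norm_sq, norm_smul, mul_pow, Real.norm_eq_abs,
    sq_abs] at h1
  have h3 : L / 2 * ((-(1 / L)) ^ 2 * ‖gradient ψ w‖ ^ 2) = 1 / (2 * L) * ‖gradient ψ w‖ ^ 2 := by
    field_simp
  have h4 : -(1 / L) * ‖gradient ψ w‖ ^ 2 = -2 * (1 / (2 * L) * ‖gradient ψ w‖ ^ 2) := by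
    field_simp
  have h5 : 1 / (2 * L) * ‖gradient ψ w‖ ^ 2 ≤ B := by linarith
  rw [div_mul_eq_mul_div, one_mul, div_le_iff₀ (by positivity)] at h5
  linarith

end IsSmooth

namespace IsStronglyConvex

lemma add_prox {l c : ℝ} {ψ : E d → ℝ} (h : IsStronglyConvex l ψ) (hd : Differentiable ℝ ψ)
    (p : E d) : IsStronglyConvex (l + c) (fun w => ψ w + c / 2 * ‖w - p‖ ^ 2) := by
  intro x y
  rw [(hasGradientAt_add_prox (hd y).hasGradientAt c p).gradient]
  have h1 := h x y
  have h2 : ‖x - p‖ ^ 2 = ‖x - y‖ ^ 2 + 2 * ⟪y - p, x - y⟫ + ‖y - p‖ ^ 2 := by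
    rw [show x - p = (x - y) + (y - p) by abel, norm_add_sq_real, real_inner_comm]
  simp only [inner_add_left, real_inner_smul_left, h2]
  linarith

/-- The Polyak–Łojasiewicz inequality. -/
lemma sub_le {l : ℝ} (hl : 0 < l) {ψ : E d → ℝ} (h : IsStronglyConvex l ψ) (w x : E d) :
    2 * l * (ψ w - ψ x) ≤ ‖gradient ψ w‖ ^ 2 := by
  have h1 := h x w
  have h2 := neg_le_of_abs_le (abs_real_inner_le_norm (gradient ψ w) (x - w))
  nlinarith [sq_nonneg (‖gradient ψ w‖ - l * ‖x - w‖), mul_le_mul_of_nonneg_left h1 hl.le,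
    mul_le_mul_of_nonneg_left h2 hl.le]

end IsStronglyConvex

/-! ### Linear convergence of InexactDANE -/

/-- One InexactDANE step moves approximately along the negative gradient. -/
lemma IsInexactDANEStep.norm_smul_add_gradient_le (hK : 0 < K) {Φ : Fin K → E d → ℝ} {l : ℝ}
    (hl : 0 < l) (hΦ : ∀ k, IsSmooth (2 * l) (Φ k)) {v v' : E d}
    (h : IsInexactDANEStep Φ 1 (1 / 8) (12 * l) v v') :
    ‖(12 * l) • (v' - v) + gradient (avg Φ) v‖ ≤ 7 / 20 * ‖gradient (avg Φ) v‖ := by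
  obtain ⟨z, hz, rfl⟩ := h
  set G := gradient (avg Φ) v
  have key (k) : ‖z k - (v - (1 / (12 * l)) • G)‖ ≤ 1 / (12 * l) * (7 / 20 * ‖G‖) := by
    have h1 := hz k
    rw [(hasGradientAt_localObj (hΦ k).1 1 (12 * l) v (z k)).gradient,
      (hasGradientAt_localObj (hΦ k).1 1 (12 * l) v v).gradient] at h1
    simp only [one_smul, sub_self, smul_zero, add_zero, sub_sub_cancel] at h1
    have h2 := (hΦ k).2 (z k) v
    set D := gradient (Φ k) (z k) - gradient (Φ k) v with hD
    set R := gradient (Φ k) (z k) - (gradient (Φ k) v - G) + (12 * l) • (z k - v) with hR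
    have h3 : (12 * l) • (z k - v) = R - D - G := by rw [hR, hD]; module
    have h4 : 12 * l * ‖z k - v‖ ≤ ‖R‖ + ‖D‖ + ‖G‖ := by
      have : ‖(12 * l) • (z k - v)‖ ≤ ‖R‖ + ‖D‖ + ‖G‖ := by
        rw [h3]
        exact (norm_sub_le _ _).trans (add_le_add_left (norm_sub_le _ _) _)
      rwa [norm_smul, Real.norm_of_nonneg (by positivity)] at this
    have h5 : z k - (v - (1 / (12 * l)) • G) = (1 / (12 * l)) • (R - D) := by
      have : R - D = (12 * l) • (z k - v) + G := by rw [h3]; abel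
      rw [this, smul_add, smul_smul, one_div_mul_cancel (by positivity), one_smul]
      abel
    rw [h5, norm_smul, Real.norm_of_nonneg (by positivity)]
    gcongr
    -- `‖R‖ ≤ ‖G‖/8` and `‖D‖ ≤ (‖R‖ + ‖D‖ + ‖G‖)/6` give `‖D‖ ≤ 9/40 ‖G‖`, and 1/8 + 9/40 = 7/20.
    have := norm_sub_le R D
    linarith
  have h6 := norm_avg_sub_le hK key
  have h7 : (12 * l) • ((1 / (K : ℝ)) • ∑ k, z k - v) + G
      = (12 * l) • ((1 / (K : ℝ)) • ∑ k, z k - (v - (1 / (12 * l)) • G)) := by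
    simp only [smul_sub, smul_smul (12 * l) (1 / (12 * l)),
      mul_one_div_cancel (show 12 * l ≠ 0 by positivity), one_smul]
    abel
  rw [h7, norm_smul, Real.norm_of_nonneg (by positivity)]
  refine (mul_le_mul_of_nonneg_left h6 (by positivity)).trans_eq ?_
  field_simp

lemma IsInexactDANEStep.gap_le (hK : 0 < K) {Φ : Fin K → E d → ℝ} {l : ℝ}
    (hl : 0 < l) (hΦ : ∀ k, IsSmooth (2 * l) (Φ k)) (hc : IsStronglyConvex l (avg Φ)) {v v' : E d}
    (h : IsInexactDANEStep Φ 1 (1 / 8) (12 * l) v v') (x : E d) :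
    avg Φ v' - avg Φ x ≤ 13 / 14 * (avg Φ v - avg Φ x) := by
  have h1 := h.norm_smul_add_gradient_le hK hl hΦ
  have h2 := (IsSmooth.avg hK hΦ).le_quadratic v (v' - v)
  have h3 := hc.sub_le hl v x
  rw [add_sub_cancel] at h2
  set G := gradient (avg Φ) v
  have h4 : ‖(12 * l) • (v' - v) + G‖ ^ 2 ≤ (7 / 20 * ‖G‖) ^ 2 := by gcongr
  rw [norm_add_sq_real, real_inner_smul_left, norm_smul, mul_pow, Real.norm_eq_abs, sq_abs,
    real_inner_comm] at h4
  have h5 : 0 ≤ l ^ 2 * ‖v' - v‖ ^ 2 := by positivity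
  -- The factor 28 = 2 · 14 matches the `2 * l` of the Polyak–Łojasiewicz bound `h3`, which then
  -- yields a decrease by 1/14 of the gap.
  have h6 : 28 * l * (avg Φ v' - avg Φ v) ≤ -‖G‖ ^ 2 := by
    nlinarith [mul_le_mul_of_nonneg_left h2 hl.le]
  have h7 : 28 * l * (avg Φ v' - avg Φ v) ≤ 28 * l * (-1 / 14 * (avg Φ v - avg Φ x)) := by
    linarith
  linarith [le_of_mul_le_mul_left h7 (by positivity)]

lemma IsInexactDANE.gap_le (hK : 0 < K) {Φ : Fin K → E d → ℝ} {l : ℝ}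
    (hl : 0 < l) (hΦ : ∀ k, IsSmooth (2 * l) (Φ k)) (hc : IsStronglyConvex l (avg Φ)) {s : ℕ}
    {v v' : E d} (h : IsInexactDANE Φ 1 (1 / 8) (12 * l) s v v') (x : E d) :
    avg Φ v' - avg Φ x ≤ (13 / 14) ^ s * (avg Φ v - avg Φ x) := by
  obtain ⟨u, rfl, rfl, hu⟩ := h
  have key : ∀ j ≤ s, avg Φ (u j) - avg Φ x ≤ (13 / 14) ^ j * (avg Φ (u 0) - avg Φ x) := by
    intro j hj
    induction j with
    | zero => simp
    | succ j ih =>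
      have h1 := (hu j hj).gap_le hK hl hΦ hc x
      have h2 := ih (Nat.le_of_succ_le hj)
      rw [pow_succ]
      linarith
  exact key s le_rfl

/-- Polyak–Łojasiewicz at the start turns the gradient into a gap; smoothness at the end turns the
contracted gap back into a gradient. -/
lemma IsInexactDANE.norm_gradient_sq_le (hK : 0 < K) {Φ : Fin K → E d → ℝ} {l : ℝ}
    (hl : 0 < l) (hΦ : ∀ k, IsSmooth (2 * l) (Φ k)) (hc : IsStronglyConvex l (avg Φ)) {s : ℕ}
    {v v' : E d} (h : IsInexactDANE Φ 1 (1 / 8) (12 * l) s v v') :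
    ‖gradient (avg Φ) v'‖ ^ 2 ≤ 2 * (13 / 14) ^ s * ‖gradient (avg Φ) v‖ ^ 2 := by
  have h1 := (IsSmooth.avg hK hΦ).norm_gradient_sq_le (by positivity) v'
    (B := (13 / 14) ^ s * (‖gradient (avg Φ) v‖ ^ 2 / (2 * l))) fun x => by
      refine (h.gap_le hK hl hΦ hc x).trans ?_
      gcongr
      rw [le_div_iff₀ (by positivity)]
      linarith [hc.sub_le hl v x]
  refine h1.trans_eq ?_
  field_simp

/-! ### Inexact accelerated proximal point method -/

/-- The Lyapunov function of the accelerated proximal point method. -/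
noncomputable def potential (ψ : E d → ℝ) (m : ℝ) (xs w z : E d) : ℝ :=
  ψ w - ψ xs + m / 2 * ‖z - xs‖ ^ 2

lemma IsStronglyConvex.apply_convexComb_le {l : ℝ} {ψ : E d → ℝ} (h : IsStronglyConvex l ψ)
    {a : ℝ} (ha0 : 0 ≤ a) (ha1 : a ≤ 1) (x y : E d) :
    ψ (a • x + (1 - a) • y)
      ≤ a * ψ x + (1 - a) * ψ y - l / 2 * (a * (1 - a)) * ‖x - y‖ ^ 2 := by
  set c := a • x + (1 - a) • y with hc
  have h1 := h x c
  have h2 := h y c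
  have e1 : x - c = (1 - a) • (x - y) := by rw [hc]; module
  have e2 : y - c = (-a) • (x - y) := by rw [hc]; module
  rw [e1, inner_smul_right, norm_smul, mul_pow, Real.norm_eq_abs, sq_abs] at h1
  rw [e2, inner_smul_right, norm_smul, mul_pow, Real.norm_eq_abs, sq_abs] at h2
  have h3 := mul_le_mul_of_nonneg_left h1 ha0
  have h4 := mul_le_mul_of_nonneg_left h2 (sub_nonneg.2 ha1)
  linarith

/-- One step of the accelerated proximal point method whose proximal subproblem is solved up to
a gradient error. Here `w + a • u` is the new iterate, `w + u` the new estimate point, and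
`(a • z + w) / (1 + a)` the proximal centre. -/
lemma potential_step_le {ψ : E d → ℝ} (hd : Differentiable ℝ ψ) {m κ a : ℝ} (hm : 0 < m)
    (ha0 : 0 < a) (ha1 : a ≤ 1) (hκ : a ^ 2 * (m + κ) = m) (hc : IsStronglyConvex m ψ)
    {xs : E d} (hxs : ∀ x, ψ xs ≤ ψ x) (w z u y : E d) (hy : (1 + a) • y = a • z + w) :
    (1 - a / 4) * potential ψ m xs (w + a • u) (w + u) ≤ (1 - a) * potential ψ m xs w z
      + 2 * a / m * ‖gradient (fun w => ψ w + κ / 2 * ‖w - y‖ ^ 2) (w + a • u)‖ ^ 2 := by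
  set e := gradient (fun w => ψ w + κ / 2 * ‖w - y‖ ^ 2) (w + a • u) with he
  -- Testing strong convexity of the subproblem at this point makes its distance to the new iterate
  -- `a` times that from the new estimate point to `xs`.
  set x := a • xs + (1 - a) • w with hx
  have h1 := (hc.add_prox (c := κ) hd y) x (w + a • u)
  rw [← he] at h1
  have h2 := hc.apply_convexComb_le ha0.le ha1 xs w
  rw [← hx] at h2
  have e1 : x - (w + a • u) = (-a) • (w + u - xs) := by rw [hx]; module
  rw [e1, inner_smul_right, norm_smul, mul_pow, Real.norm_eq_abs, sq_abs, neg_sq] at h1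
  have h3 : ‖x - y‖ ^ 2 * (1 + a) ≤ a ^ 2 * (‖z - xs‖ ^ 2 + a * ‖xs - w‖ ^ 2) := by
    have e2 : (1 + a) • (x - y) = (-a) • ((z - xs) + a • (w - xs)) := by
      rw [smul_sub, hy, hx]; module
    have e3 : (1 + a) ^ 2 * ‖x - y‖ ^ 2 = a ^ 2 * ‖(z - xs) + a • (w - xs)‖ ^ 2 := by
      have := congrArg (fun v => ‖v‖ ^ 2) e2
      simpa only [norm_smul, mul_pow, Real.norm_eq_abs, sq_abs, neg_sq] using this
    have e4 : ‖(z - xs) + a • (w - xs)‖ ^ 2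
        ≤ (1 + a) * (‖z - xs‖ ^ 2 + a * ‖xs - w‖ ^ 2) := by
      have := sq_nonneg ‖(z - xs) - (w - xs)‖
      rw [norm_sub_sq_real] at this
      rw [norm_add_sq_real, norm_smul, mul_pow, Real.norm_eq_abs, sq_abs, inner_smul_right,
        norm_sub_rev xs w]
      nlinarith
    have e5 : (1 + a) * (‖x - y‖ ^ 2 * (1 + a))
        ≤ (1 + a) * (a ^ 2 * (‖z - xs‖ ^ 2 + a * ‖xs - w‖ ^ 2)) := by
      nlinarith [mul_le_mul_of_nonneg_left e4 (sq_nonneg a)]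
    exact le_of_mul_le_mul_left e5 (by positivity)
  have hκ0 : 0 ≤ κ := by nlinarith [mul_pos hm ha0, mul_pos ha0 ha0]
  -- The `‖xs - w‖` term here is exactly cancelled by the strong convexity gain in `h2`.
  have h4 : κ / 2 * ‖x - y‖ ^ 2
      ≤ m / 2 * (1 - a) * (‖z - xs‖ ^ 2 + a * ‖xs - w‖ ^ 2) := by
    have : (1 + a) * (κ / 2 * ‖x - y‖ ^ 2)
        ≤ (1 + a) * (m / 2 * (1 - a) * (‖z - xs‖ ^ 2 + a * ‖xs - w‖ ^ 2)) := by
      have e6 := mul_le_mul_of_nonneg_left h3 (show 0 ≤ κ / 2 by positivity)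
      have e7 : a ^ 2 * κ = m * (1 - a ^ 2) := by linarith
      calc _ = κ / 2 * (‖x - y‖ ^ 2 * (1 + a)) := by ring
        _ ≤ _ := e6
        _ = (a ^ 2 * κ) / 2 * (‖z - xs‖ ^ 2 + a * ‖xs - w‖ ^ 2) := by ring
        _ = _ := by rw [e7]; ring
    exact le_of_mul_le_mul_left this (by positivity)
  -- Young's inequality, weighted to cost only a fraction `a / 4` of the new distance term.
  have h5 : a * ⟪e, w + u - xs⟫ ≤ a / 4 * (m / 2 * ‖w + u - xs‖ ^ 2) + 2 * a / m * ‖e‖ ^ 2 := by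
    have e8 := real_inner_le_norm e (w + u - xs)
    have e9 : ‖e‖ * ‖w + u - xs‖ ≤ m / 8 * ‖w + u - xs‖ ^ 2 + 2 / m * ‖e‖ ^ 2 := by
      have := sq_nonneg (m * ‖w + u - xs‖ - 4 * ‖e‖)
      rw [← sub_nonneg]
      have e10 : m / 8 * ‖w + u - xs‖ ^ 2 + 2 / m * ‖e‖ ^ 2 - ‖e‖ * ‖w + u - xs‖
          = (m * ‖w + u - xs‖ - 4 * ‖e‖) ^ 2 / (8 * m) := by
        field_simp
        ring
      rw [e10]
      positivity
    have := mul_le_mul_of_nonneg_left (e8.trans e9) ha0.le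
    refine this.trans_eq ?_
    ring
  have h6 : 0 ≤ κ / 2 * ‖w + a • u - y‖ ^ 2 := by positivity
  have h7 : (m + κ) / 2 * (a ^ 2 * ‖w + u - xs‖ ^ 2) = m / 2 * ‖w + u - xs‖ ^ 2 := by
    rw [← mul_assoc, div_mul_eq_mul_div, mul_comm (m + κ), hκ]
  unfold potential
  linarith [mul_nonneg ha0.le (sub_nonneg.2 (hxs (w + a • u)))]

/-- The gradient of the proximal subproblem at its starting point is controlled by the
potential. -/
lemma norm_gradient_sq_le_potential {ψ : E d → ℝ} {m l κ a : ℝ} (hs : IsSmooth l ψ) (hm : 0 < m)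
    (ha0 : 0 < a) (hκ0 : 0 ≤ κ) (hκl : κ ≤ l) (hc : IsStronglyConvex m ψ)
    {xs : E d} (hxs : ∀ x, ψ xs ≤ ψ x) (w z y : E d) (hy : (1 + a) • y = a • z + w) :
    ‖gradient (fun w => ψ w + κ / 2 * ‖w - y‖ ^ 2) w‖ ^ 2
      ≤ 18 * l ^ 2 / m * potential ψ m xs w z := by
  have hl : 0 ≤ l := hκ0.trans hκl
  have hg0 : gradient ψ xs = 0 := by
    have : IsLocalMin ψ xs := Filter.Eventually.of_forall hxs
    rw [gradient, this.fderiv_eq_zero, map_zero]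
  rw [(hasGradientAt_add_prox (hs.1 w).hasGradientAt κ y).gradient]
  have h1 : ‖gradient ψ w‖ ≤ l * ‖w - xs‖ := by simpa [hg0] using hs.2 w xs
  have h2 : ‖w - y‖ ≤ ‖w - xs‖ + ‖z - xs‖ := by
    have e1 : (1 + a) • (w - y) = a • ((w - xs) - (z - xs)) := by rw [smul_sub, hy]; module
    have e2 := congrArg norm e1
    rw [norm_smul, norm_smul, Real.norm_of_nonneg (by positivity), Real.norm_of_nonneg ha0.le] at e2
    have e3 := norm_sub_le (w - xs) (z - xs)
    nlinarith [norm_nonneg (w - y), norm_nonneg ((w - xs) - (z - xs))]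
  have h3 : m / 2 * ‖w - xs‖ ^ 2 ≤ ψ w - ψ xs := by
    have := hc w xs
    rw [hg0, inner_zero_left] at this
    linarith
  have h4 : ‖gradient ψ w + κ • (w - y)‖ ≤ l * (2 * ‖w - xs‖ + ‖z - xs‖) := by
    refine (norm_add_le _ _).trans ?_
    rw [norm_smul, Real.norm_of_nonneg hκ0]
    have : κ * ‖w - y‖ ≤ l * (‖w - xs‖ + ‖z - xs‖) := by gcongr
    linarith
  have h5 : (2 * ‖w - xs‖ + ‖z - xs‖) ^ 2 ≤ 9 * (‖w - xs‖ ^ 2 + ‖z - xs‖ ^ 2) := by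
    nlinarith [sq_nonneg (‖w - xs‖ - ‖z - xs‖), sq_nonneg ‖w - xs‖, sq_nonneg ‖z - xs‖]
  calc ‖gradient ψ w + κ • (w - y)‖ ^ 2 ≤ (l * (2 * ‖w - xs‖ + ‖z - xs‖)) ^ 2 := by gcongr
    _ ≤ l ^ 2 * (9 * (‖w - xs‖ ^ 2 + ‖z - xs‖ ^ 2)) := by rw [mul_pow]; gcongr
    _ = 18 * l ^ 2 / m * (m / 2 * ‖w - xs‖ ^ 2 + m / 2 * ‖z - xs‖ ^ 2) := by field_simp; ring
    _ ≤ 18 * l ^ 2 / m * potential ψ m xs w z := by unfold potential; gcongr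

lemma potential_nonneg {ψ : E d → ℝ} {m : ℝ} (hm : 0 ≤ m) {xs : E d} (hxs : ∀ x, ψ xs ≤ ψ x)
    (w z : E d) : 0 ≤ potential ψ m xs w z :=
  add_nonneg (sub_nonneg.2 (hxs w)) (by positivity)

lemma IsSmooth.mono {L L' : ℝ} {ψ : E d → ℝ} (h : IsSmooth L ψ) (hL : L ≤ L') : IsSmooth L' ψ :=
  ⟨h.1, fun x y => (h.2 x y).trans (by gcongr)⟩

/-- Started at its fixed point, the momentum recursion is stationary. -/
lemma momentum_eq {a q ζ : ℝ} (ha : 0 ≤ a) (haq : a ^ 2 = q) (hζ : 0 ≤ ζ)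
    (h : ζ ^ 2 = (1 - ζ) * a ^ 2 + q * ζ) : ζ = a := by
  rw [← sq_eq_sq₀ hζ ha]
  linear_combination h - ζ * haq

theorem IsAIDERun.gap_le (hK : 0 < K) {G : Fin K → E d → ℝ} {L ε : ℝ} (hε : 0 < ε) (hεL : ε ≤ L)
    (hG : ∀ k, IsSmooth (L + ε) (G k)) (hc : IsStronglyConvex ε (avg G)) {s : ℕ}
    (hs : (13 / 14 : ℝ) ^ s ≤ (ε / (L + ε)) ^ 2 / 288) {w0 xs : E d}
    (hxs : ∀ x, avg G xs ≤ avg G x) {T : ℕ} {w : ℕ → E d}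
    (h : IsAIDERun G w0 ε L s 1 (1 / 8) (12 * (L + ε)) T w) :
    avg G (w T) - avg G xs ≤ 2 * (1 - √(ε / (ε + L)) / 2) ^ T * (avg G w0 - avg G xs) := by
  obtain ⟨y, ζ, hw0, hy0, hζ0, hstep⟩ := h
  have hL : 0 < L := hε.trans_le hεL
  set a := √(ε / (ε + L)) with ha
  have ha0 : 0 < a := Real.sqrt_pos.2 (by positivity)
  have ha2 : a ^ 2 = ε / (ε + L) := Real.sq_sqrt (by positivity)
  have ha1 : a ≤ 1 := Real.sqrt_le_one.2 ((div_le_one (by positivity)).2 (by linarith))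
  have hκ : a ^ 2 * (ε + L) = ε := by rw [ha2]; field_simp
  have hsm : IsSmooth (L + ε) (avg G) := IsSmooth.avg hK hG
  have key : ∀ t ≤ T, ζ t = a ∧ ∃ z, (1 + a) • y t = a • z + w t ∧
      potential (avg G) ε xs (w t) z ≤ (1 - a / 2) ^ t * potential (avg G) ε xs w0 w0 := by
    intro t ht
    induction t with
    | zero => exact ⟨hζ0, w0, by rw [hy0, hw0]; module, by simp [hw0]⟩
    | succ t ih =>
      obtain ⟨hζ, z, hyz, hV⟩ := ih (Nat.le_of_succ_le ht)
      obtain ⟨hin, hζ1, hrec, hy1⟩ := hstep t ht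
      rw [hζ] at hrec hy1
      have hζ' : ζ (t + 1) = a := momentum_eq ha0.le ha2 hζ1.1.le hrec
      set u := a⁻¹ • (w (t + 1) - w t) with hu
      have hwu : w (t + 1) = w t + a • u := by
        rw [hu, smul_inv_smul₀ ha0.ne']; abel
      refine ⟨hζ', w t + u, ?_, ?_⟩
      · rw [hy1, hζ', hwu, smul_add, add_sub_cancel_left, smul_smul (1 + a)]
        have : (1 + a) * (a * (1 - a) / (a ^ 2 + a)) = 1 - a := by field_simp; ring
        rw [this]
        module
      · have h1 := hin.norm_gradient_sq_le hK (Φ := addProx G L (y t)) (l := L + ε) (by positivity)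
          (fun k => ((hG k).add_prox hL.le (y t)).mono (by linarith)) (by
            rw [avg_addProx hK, add_comm L]
            exact hc.add_prox hsm.1 (y t))
        rw [avg_addProx hK] at h1
        have h2 := norm_gradient_sq_le_potential hsm hε ha0 hL.le (by linarith) hc hxs
          (w t) z (y t) hyz
        have h3 := potential_step_le hsm.1 hε ha0 ha1 hκ hc hxs (w t) z u (y t) hyz
        rw [← hwu] at h3
        have hV0 := potential_nonneg hε.le hxs (w t) z
        set V := potential (avg G) ε xs (w t) z
        set V' := potential (avg G) ε xs (w (t + 1)) (w t + u)
        -- The constant 288 is chosen here: 2 · 2 · 18 / 288 = 1/4.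
        have h4 : 2 * a / ε * ‖gradient (fun w => avg G w + L / 2 * ‖w - y t‖ ^ 2) (w (t + 1))‖ ^ 2
            ≤ a / 4 * V := by
          calc _ ≤ 2 * a / ε * (2 * ((ε / (L + ε)) ^ 2 / 288) * (18 * (L + ε) ^ 2 / ε * V)) := by
                gcongr
                exact h1.trans (by gcongr)
            _ = a / 4 * V := by field_simp; ring
        -- `1 - a + a/4 ≤ (1 - a/4)(1 - a/2)`, with slack `a²/8`.
        have h5 : (1 - a / 4) * V' ≤ (1 - a / 4) * ((1 - a / 2) * V) := by
          nlinarith [mul_nonneg (sq_nonneg a) hV0]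
        have h6 := le_of_mul_le_mul_left h5 (by linarith)
        rw [pow_succ']
        have h7 := mul_le_mul_of_nonneg_left hV (show 0 ≤ 1 - a / 2 by linarith)
        linarith
  obtain ⟨-, z, -, hV⟩ := key T le_rfl
  have h1 : avg G (w T) - avg G xs ≤ potential (avg G) ε xs (w T) z :=
    le_add_of_nonneg_right (by positivity)
  have h2 : potential (avg G) ε xs w0 w0 ≤ 2 * (avg G w0 - avg G xs) := by
    have hg0 : gradient (avg G) xs = 0 := by
      have : IsLocalMin (avg G) xs := Filter.Eventually.of_forall hxs
      rw [gradient, this.fderiv_eq_zero, map_zero]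
    have := hc w0 xs
    rw [hg0, inner_zero_left] at this
    unfold potential
    linarith
  have h3 := mul_le_mul_of_nonneg_left h2 (pow_nonneg (show 0 ≤ 1 - a / 2 by linarith) T)
  linarith

/-! ### Iteration counts -/

lemma inner_contraction_le {L ε : ℝ} (hε : 0 < ε) (hεL : ε ≤ L) {s : ℕ}
    (hs : 200 * (1 + Real.log (L / ε)) ≤ s) :
    (13 / 14 : ℝ) ^ s ≤ (ε / (L + ε)) ^ 2 / 288 := by
  have hL : 0 < L := hε.trans_le hεL
  have hx : 0 ≤ Real.log (L / ε) := Real.log_nonneg ((one_le_div hε).2 hεL)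
  -- 1152 = 4 · 288; the 4 pays for replacing `L + ε` by `2L`.
  have h14 : (1152 : ℝ) ≤ Real.exp 14 := by
    have h1 : (2 : ℝ) ≤ Real.exp 1 := by linarith [Real.add_one_le_exp (1 : ℝ)]
    calc (1152 : ℝ) ≤ 2 ^ 14 := by norm_num
      _ ≤ Real.exp 1 ^ 14 := by gcongr
      _ = Real.exp 14 := by rw [← Real.exp_nat_mul]; norm_num
  have h2 : Real.exp (-(2 * Real.log (L / ε))) = (ε / L) ^ 2 := by
    rw [← mul_neg, ← Real.log_inv, inv_div, mul_comm, Real.exp_mul, Real.exp_log (by positivity)]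
    norm_num
  calc (13 / 14 : ℝ) ^ s ≤ Real.exp (-1 / 14) ^ s := by
        gcongr
        linarith [Real.add_one_le_exp (-1 / 14 : ℝ)]
    _ = Real.exp (s * (-1 / 14)) := by rw [Real.exp_nat_mul]
    _ ≤ Real.exp (-14 + -(2 * Real.log (L / ε))) := Real.exp_le_exp.2 (by linarith)
    _ = (Real.exp 14)⁻¹ * (ε / L) ^ 2 := by rw [Real.exp_add, Real.exp_neg, h2]
    _ ≤ 1152⁻¹ * (ε / L) ^ 2 := by gcongr
    _ = (ε / (L + L)) ^ 2 / 288 := by field_simp; norm_num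
    _ ≤ (ε / (L + ε)) ^ 2 / 288 := by gcongr

lemma outer_contraction_le {L ε : ℝ} (hε : 0 < ε) (hεL : ε ≤ L) (hε2 : ε ≤ 1 / 2) {t : ℕ}
    (ht : 200 * (√(L / ε) * Real.log (1 / ε)) * (1 + Real.log (L / ε)) ≤ t) :
    2 * (1 - √(ε / (ε + L)) / 2) ^ t ≤ ε := by
  have hL : 0 < L := hε.trans_le hεL
  have hx : 0 ≤ Real.log (L / ε) := Real.log_nonneg ((one_le_div hε).2 hεL)
  have hl : 0 ≤ Real.log (1 / ε) := Real.log_nonneg ((one_le_div hε).2 (by linarith))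
  set a := √(ε / (ε + L)) with ha
  have ha0 : 0 ≤ a := Real.sqrt_nonneg _
  have ha1 : a ≤ 1 := Real.sqrt_le_one.2 ((div_le_one (by positivity)).2 (by linarith))
  have h1 : 1 / 2 ≤ a * √(L / ε) := by
    rw [ha, ← Real.sqrt_mul (by positivity)]
    refine Real.le_sqrt_of_sq_le ?_
    rw [div_mul_div_comm, le_div_iff₀ (by positivity)]
    nlinarith
  have h2 : 200 * (√(L / ε) * Real.log (1 / ε)) ≤ t :=
    (le_mul_of_one_le_right (by positivity) (by linarith)).trans ht
  have h3 : 4 * Real.log (1 / ε) ≤ t * a := by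
    nlinarith [mul_le_mul_of_nonneg_left h2 ha0, mul_le_mul_of_nonneg_right h1 hl]
  -- Aiming for `ε ^ 2` lets `ε ≤ 1 / 2` absorb the leading factor 2.
  have h4 : (1 - a / 2) ^ t ≤ ε ^ 2 := by
    calc (1 - a / 2) ^ t ≤ Real.exp (-(a / 2)) ^ t := by
          gcongr
          · linarith
          · linarith [Real.add_one_le_exp (-(a / 2))]
      _ = Real.exp (t * -(a / 2)) := by rw [Real.exp_nat_mul]
      _ ≤ Real.exp (Real.log ε * 2) := by
          rw [one_div, Real.log_inv] at h3
          exact Real.exp_le_exp.2 (by linarith)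
      _ = ε ^ 2 := by rw [Real.exp_mul, Real.exp_log hε]; norm_num
  nlinarith

/-- `ψ` is bounded below by its minimum, so the quadratic term makes the sum coercive. -/
lemma exists_forall_prox_le {ψ : E d → ℝ} (hψ : Continuous ψ) {xs : E d}
    (hxs : ∀ x, ψ xs ≤ ψ x) {ε : ℝ} (hε : 0 < ε) (w0 : E d) :
    ∃ x, ∀ w, ψ x + ε / 2 * ‖x - w0‖ ^ 2 ≤ ψ w + ε / 2 * ‖w - w0‖ ^ 2 := by
  refine Continuous.exists_forall_le' (f := fun w => ψ w + ε / 2 * ‖w - w0‖ ^ 2) (by fun_prop) w0 ?_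
  filter_upwards [(tendsto_dist_right_cocompact_atTop w0).eventually_ge_atTop
    (1 + 2 / ε * (ψ w0 - ψ xs))] with w hw
  rw [dist_eq_norm] at hw
  have h0 : 0 ≤ 2 / ε * (ψ w0 - ψ xs) := mul_nonneg (by positivity) (sub_nonneg.2 (hxs w0))
  have h1 : 2 / ε * (ψ w0 - ψ xs) ≤ ‖w - w0‖ ^ 2 := by nlinarith
  have h2 := mul_le_mul_of_nonneg_left h1 (show 0 ≤ ε / 2 by positivity)
  have h3 : ε / 2 * (2 / ε * (ψ w0 - ψ xs)) = ψ w0 - ψ xs := by field_simp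
  simp only [sub_self, norm_zero]
  linarith [hxs w]

end AIDE

open AIDE in
theorem corollary3 :
    ∃ C : ℝ, 0 < C ∧
      ∀ (d K : ℕ) (_hK : 0 < K) (F : Fin K → AIDE.E d → ℝ) (L : ℝ) (w0 what : AIDE.E d),
        (∀ k, AIDE.IsSmooth L (F k)) →
        AIDE.IsWeaklyConvex (AIDE.avg F) →
        (∀ w, AIDE.avg F what ≤ AIDE.avg F w) →
        ∀ ε : ℝ, 0 < ε → ε ≤ L → ε ≤ 1 / 2 →
        ∀ s : ℕ, C * (1 + Real.log (L / ε)) ≤ (s : ℝ) →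
        ∀ t : ℕ, C * (√(L / ε) * Real.log (1 / ε)) * (1 + Real.log (L / ε)) ≤ (t : ℝ) →
        ∀ w : ℕ → AIDE.E d,
          AIDE.IsAIDERun (AIDE.addProx F ε w0) w0 ε L s 1 (1 / 8) (12 * (L + ε)) t w →
          AIDE.avg F (w t) ≤ AIDE.avg F what +
            ε * (1 / 2 * ‖what - w0‖ ^ 2 + (AIDE.avg F w0 - AIDE.avg F what)) := by
  refine ⟨200, by norm_num, ?_⟩
  intro d K hK F L w0 what hF hconv hmin ε hε hεL hε2 s hs t ht w hrun
  have hd : Differentiable ℝ (avg F) := (IsSmooth.avg hK hF).1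
  have hc : IsStronglyConvex ε (avg (addProx F ε w0)) := by
    have := hconv.add_prox (c := ε) hd w0
    rwa [zero_add, ← avg_addProx hK] at this
  obtain ⟨xs, hxs⟩ := exists_forall_prox_le hd.continuous hmin hε w0
  have hgap := hrun.gap_le (G := addProx F ε w0) hK hε hεL (fun k => (hF k).add_prox hε.le w0) hc
    (inner_contraction_le hε hεL hs) (xs := xs) (by simpa only [avg_addProx hK] using hxs)
  simp only [avg_addProx hK, sub_self, norm_zero] at hgap
  have hxs0 : 0 ≤ ε / 2 * ‖xs - w0‖ ^ 2 := by positivity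
  have hwt0 : 0 ≤ ε / 2 * ‖w t - w0‖ ^ 2 := by positivity
  -- The proximal term vanishes at `w0`, so the initial gap of `f_ε` is at most that of `f`.
  have h1 : avg F w0 + ε / 2 * 0 ^ 2 - (avg F xs + ε / 2 * ‖xs - w0‖ ^ 2)
      ≤ avg F w0 - avg F what := by linarith [hmin xs]
  have h2 := mul_le_mul (outer_contraction_le hε hεL hε2 ht) h1 (by
    have := hxs w0
    simp only [sub_self, norm_zero] at this
    linarith) hε.le
  linarith [hxs what]
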